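/- Let $n\ge 1$. Equip $\mathrm{GL}_n(\mathbb C)$ with the left-invariant semi-Riemannian metric $g$ which on the Lie algebra $\mathbb C^{n\times n}$ is given by $g(Z,W)=-\operatorname{Re}\operatorname{tr}(ZW)$, and equip $\mathrm{GL}_n(\mathbb R)\subset \mathrm{GL}_n(\mathbb C)$ with the induced semi-Riemannian metric, also denoted by $g$. For smooth functions $\phi,\psi:\mathrm{GL}_n(\mathbb R)\to\mathbb C$ let $\tau$ be the Laplace-Beltrami operator (tension field) and $\kappa$ the conformality operator, in local coordinates $$\tau(\phi)=\sum_{i,j}\frac1{\sqrt{|g|}}\frac{\partial}{\partial x_j}\Big(g^{ij}\sqrt{|g|}\,\frac{\partial\phi}{\partial x_i}\Big),\qquad \kappa(\phi,\psi)=\sum_{i,j}g^{ij}\,\frac{\partial\phi}{\partial x_i}\frac{\partial\psi}{\partial x_j}.$$ Here $|g|$ in $\sqrt{|g|}$ is the absolute value of $\det(g_{ij})$. Let $v$ be a non-zero element of $\mathbb C^n$ (elements of $\mathbb C^n$ are row vectors), and for $a\in\mathbb C^n$ put $$\phi_a:\mathrm{GL}_n(\mathbb R)\to\mathbb C,\qquad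 \phi_a(x)=\operatorname{tr}(v^t a\,x^t).$$ Then $\mathcal E_v=\{\phi_a \mid a\in\mathbb C^n\}$ is a complex vector space of dimension $n$, consisting of smooth functions, and it is an eigenfamily on $\mathrm{GL}_n(\mathbb R)$: for all $\phi,\psi\in\mathcal E_v$, $$\tau(\phi)=-n\cdot\phi\quad\text{and}\quad \kappa(\phi,\psi)=-\phi\cdot\psi.$$ -/

import Mathlib

open scoped Manifold ContDiff Matrix
-- The norm only serves to give spaces of square matrices their usual smooth structure.
open scoped Matrix.Norms.L2Operator

noncomputable section

namespace SemiRiemannian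

section General

variable {E : Type*} [NormedAddCommGroup E] [NormedSpace ℝ E]
  {M : Type*} [TopologicalSpace M] [ChartedSpace E M]

/-- The tangent vector of `M` at the point with coordinates `y` in the preferred chart at `p`,
which is the image of `u : E` under the differential of the inverse chart. For `u` a member of a
basis of `E`, this is a coordinate vector field of the chart. -/
def coordVec (p : M) (u y : E) : TangentSpace 𝓘(ℝ, E) ((chartAt E p).symm y) :=
  mfderiv 𝓘(ℝ, E) 𝓘(ℝ, E) (chartAt E p).symm y u

/-- The coefficient, on the vectors `u, w : E`, of a field `g` of bilinear forms in the
coordinates of the preferred chart at `p`, at the point with coordinates `y`. -/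
def coordCoeff (g : ∀ x : M, LinearMap.BilinForm ℝ (TangentSpace 𝓘(ℝ, E) x))
    (p : M) (u w y : E) : ℝ :=
  g ((chartAt E p).symm y) (coordVec p u y) (coordVec p w y)

variable (E M) in
/-- A semi-Riemannian metric on a manifold `M` modelled on `E`: a symmetric nondegenerate bilinear
form on each tangent space, with smooth coefficients in charts. -/
structure Metric where
  /-- the bilinear form on the tangent space at a point -/
  form : ∀ x : M, LinearMap.BilinForm ℝ (TangentSpace 𝓘(ℝ, E) x)
  symm : ∀ x, (form x).IsSymm
  nondegenerate : ∀ x, (form x).Nondegenerate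
  smooth : ∀ (p : M) (u w : E), ContDiffOn ℝ ∞ (coordCoeff form p u w) (chartAt E p).target

variable {ι : Type*} [Fintype ι] [DecidableEq ι]

/-- The matrix `(g_ij)` of the metric in the coordinates of the preferred chart at `p`
(linear coordinates on `E` being taken with respect to the basis `b`), at the point with
coordinates `y`. -/
def Metric.gram (g : Metric E M) (b : Module.Basis ι ℝ E) (p : M) (y : E) : Matrix ι ι ℝ :=
  Matrix.of fun i j => coordCoeff g.form p (b i) (b j) y

/-- The partial derivative of a function along the `i`-th linear coordinate of `E`. -/
def partialDeriv (b : Module.Basis ι ℝ E) (i : ι) (f : E → ℂ) (y : E) : ℂ :=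
  lineDeriv ℝ f y (b i)

/-- The Laplace-Beltrami operator (tension field)
`τ(φ) = ∑ i j, |g|^(-1/2) ∂_j (g^ij |g|^(1/2) ∂_i φ)`, computed at each point `p` in the preferred
chart at `p`. The value depends neither on the chart nor on the basis `b`, which only serves to
choose linear coordinates on the model space `E`. -/
def tension (g : Metric E M) (b : Module.Basis ι ℝ E) (φ : M → ℂ) (p : M) : ℂ :=
  ∑ i, ∑ j, ((1 / √|(g.gram b p (chartAt E p p)).det| : ℝ) : ℂ) *
    partialDeriv b j
      (fun y => (((g.gram b p y)⁻¹ i j * √|(g.gram b p y).det| : ℝ) : ℂ) *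
        partialDeriv b i (φ ∘ (chartAt E p).symm) y)
      (chartAt E p p)

/-- The conformality operator `κ(φ, ψ) = ∑ i j, g^ij ∂_i φ ∂_j ψ`, computed at each point `p` in
the preferred chart at `p`. -/
def conformality (g : Metric E M) (b : Module.Basis ι ℝ E) (φ ψ : M → ℂ) (p : M) : ℂ :=
  ∑ i, ∑ j, (((g.gram b p (chartAt E p p))⁻¹ i j : ℝ) : ℂ) *
    partialDeriv b i (φ ∘ (chartAt E p).symm) (chartAt E p p) *
    partialDeriv b j (ψ ∘ (chartAt E p).symm) (chartAt E p p)

/-- `𝓔` is an eigenfamily with eigenvalues `lam` (of the tension field) and `mu` (of the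
conformality operator): a set of smooth complex-valued functions with `τ(φ) = lam φ` and
`κ(φ, ψ) = mu φ ψ` for all `φ, ψ ∈ 𝓔`. -/
structure IsEigenfamilyWith (g : Metric E M) (b : Module.Basis ι ℝ E) (𝓔 : Set (M → ℂ))
    (lam mu : ℂ) : Prop where
  smooth : ∀ φ ∈ 𝓔, ContMDiff 𝓘(ℝ, E) 𝓘(ℝ, ℂ) ∞ φ
  tension_eq : ∀ φ ∈ 𝓔, ∀ p, tension g b φ p = lam * φ p
  conformality_eq : ∀ φ ∈ 𝓔, ∀ ψ ∈ 𝓔, ∀ p, conformality g b φ ψ p = mu * (φ p * ψ p)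

end General

section Units

variable {R : Type*} [NormedRing R] [CompleteSpace R] [NormedAlgebra ℝ R]
  {S : Type*} [NormedRing S] [CompleteSpace S] [NormedAlgebra ℝ S]

/-- A continuous map between groups of units which is the restriction of a linear map `L` is
differentiable, with differential `L`. -/
theorem hasMFDerivAt_units (f : Rˣ → Sˣ) (hf : Continuous f) (L : R →L[ℝ] S)
    (h : ∀ x, (f x : S) = L x) (x : Rˣ) :
    HasMFDerivAt 𝓘(ℝ, R) 𝓘(ℝ, S) f x L := by
  refine ⟨hf.continuousAt, ?_⟩
  have : writtenInExtChartAt 𝓘(ℝ, R) 𝓘(ℝ, S) x f =ᶠ[nhds (x : R)] L := by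
    filter_upwards [(chartAt R x).open_target.mem_nhds (mem_chart_target R x)] with y hy
    have h1 : (((chartAt R x).symm y : Rˣ) : R) = y := (chartAt R x).right_inv hy
    change ((f ((chartAt R x).symm y) : Sˣ) : S) = L y
    rw [h, h1]
  exact (L.hasFDerivAt.congr_of_eventuallyEq this).hasFDerivWithinAt

/-- The differential of the inverse chart of a group of units is the identity. -/
theorem coordVec_units (p : Rˣ) (u y : R) (hy : y ∈ (chartAt R p).target) :
    coordVec p u y = u := by
  have hd : HasMFDerivAt 𝓘(ℝ, R) 𝓘(ℝ, R) (chartAt R p).symm y (ContinuousLinearMap.id ℝ R) := by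
    refine ⟨(chartAt R p).continuousAt_symm hy, ?_⟩
    have : writtenInExtChartAt 𝓘(ℝ, R) 𝓘(ℝ, R) y (chartAt R p).symm =ᶠ[nhds y] id := by
      filter_upwards [(chartAt R p).open_target.mem_nhds hy] with z hz
      exact (chartAt R p).right_inv hz
    exact ((hasFDerivAt_id (𝕜 := ℝ) y).congr_of_eventuallyEq this).hasFDerivWithinAt
  rw [coordVec, hd.mfderiv]
  rfl

end Units

section GeneralLinear

variable (n : ℕ)

/-- The scalar product `(Z, W) ↦ -Re tr(Z W)` on the Lie algebra of `GL(n, ℂ)`. -/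
def traceForm : LinearMap.BilinForm ℝ (Matrix (Fin n) (Fin n) ℂ) :=
  LinearMap.mk₂ ℝ (fun Z W => -(Z * W).trace.re)
    (by intro X Y Z; simp [add_mul]; ring)
    (by intro c X Y; simp)
    (by intro X Y Z; simp [mul_add]; ring)
    (by intro c X Y; simp)

variable {n} in
/-- The left-invariant field of bilinear forms on `GL(n, ℂ)` which extends `traceForm`. -/
def formC (z : GL (Fin n) ℂ) :
    LinearMap.BilinForm ℝ (TangentSpace 𝓘(ℝ, Matrix (Fin n) (Fin n) ℂ) z) :=
  let L : TangentSpace 𝓘(ℝ, Matrix (Fin n) (Fin n) ℂ) z →ₗ[ℝ] Matrix (Fin n) (Fin n) ℂ :=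
    (mfderiv 𝓘(ℝ, Matrix (Fin n) (Fin n) ℂ) 𝓘(ℝ, Matrix (Fin n) (Fin n) ℂ)
      (fun w : GL (Fin n) ℂ => z⁻¹ * w) z).toLinearMap
  (traceForm n).compl₁₂ L L

variable {n} in
/-- The inclusion of `GL(n, ℝ)` in `GL(n, ℂ)`. -/
def incl : GL (Fin n) ℝ →* GL (Fin n) ℂ :=
  Matrix.GeneralLinearGroup.map Complex.ofRealHom

variable {n} in
/-- The pullback of `formC` to `GL(n, ℝ)` by the inclusion in `GL(n, ℂ)`. -/
def formR (x : GL (Fin n) ℝ) :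
    LinearMap.BilinForm ℝ (TangentSpace 𝓘(ℝ, Matrix (Fin n) (Fin n) ℝ) x) :=
  let L := (mfderiv 𝓘(ℝ, Matrix (Fin n) (Fin n) ℝ) 𝓘(ℝ, Matrix (Fin n) (Fin n) ℂ)
      (incl : GL (Fin n) ℝ → GL (Fin n) ℂ) x).toLinearMap
  (formC (incl x)).compl₁₂ L L

variable {n}

theorem formC_apply (z : GL (Fin n) ℂ) (Z W : Matrix (Fin n) (Fin n) ℂ) :
    formC z Z W = -((z⁻¹).val * Z * ((z⁻¹).val * W)).trace.re := by
  have h := hasMFDerivAt_units (fun w : GL (Fin n) ℂ => z⁻¹ * w) (continuous_const_mul _)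
    (ContinuousLinearMap.mul ℝ _ (z⁻¹).val) (fun w => by simp) z
  simp only [formC, h.mfderiv]
  rfl

/-- Entrywise inclusion of real matrices in complex matrices. -/
def inclLin : Matrix (Fin n) (Fin n) ℝ →L[ℝ] Matrix (Fin n) (Fin n) ℂ :=
  LinearMap.toContinuousLinearMap
    { toFun := fun X => X.map Complex.ofReal
      map_add' := fun X Y => by ext; simp
      map_smul' := fun c X => by ext; simp }

theorem incl_val (x : GL (Fin n) ℝ) : (incl x).val = inclLin x.val := rfl

theorem continuous_incl : Continuous (incl : GL (Fin n) ℝ → GL (Fin n) ℂ) :=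
  Continuous.units_map _ (inclLin (n := n)).continuous

theorem formR_apply (x : GL (Fin n) ℝ) (X Y : Matrix (Fin n) (Fin n) ℝ) :
    formR x X Y = -((x⁻¹).val * X * ((x⁻¹).val * Y)).trace := by
  have h := hasMFDerivAt_units _ continuous_incl inclLin incl_val x
  have h2 : formR x X Y = formC (incl x) (inclLin X) (inclLin Y) := by
    simp only [formR, h.mfderiv]
    rfl
  have hm : ∀ A B : Matrix (Fin n) (Fin n) ℝ, inclLin A * inclLin B = inclLin (A * B) :=
    fun A B => (Complex.ofRealHom.mapMatrix.map_mul A B).symm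
  have ht : ∀ A : Matrix (Fin n) (Fin n) ℝ, (inclLin A).trace.re = A.trace := fun A => by
    simp [inclLin, Matrix.trace]
  rw [h2, formC_apply, ← map_inv, incl_val, hm, hm, hm, ht]

theorem formC_symm (z : GL (Fin n) ℂ) : (formC z).IsSymm :=
  ⟨fun X Y => (formC_apply z X Y).trans
    ((congrArg (fun c : ℂ => -c.re) (Matrix.trace_mul_comm _ _)).trans (formC_apply z Y X).symm)⟩

theorem formR_symm (x : GL (Fin n) ℝ) : (formR x).IsSymm :=
  ⟨fun X Y => (formR_apply x X Y).trans
    ((congrArg (fun c : ℝ => -c) (Matrix.trace_mul_comm _ _)).trans (formR_apply x Y X).symm)⟩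

theorem eq_zero_of_trace_re (A : Matrix (Fin n) (Fin n) ℂ) (h : (A * Aᴴ).trace.re = 0) :
    A = 0 := by
  have h3 : (A * Aᴴ).trace.re = ∑ i, ∑ j, Complex.normSq (A i j) := by
    simp [Matrix.trace, Matrix.mul_apply, Complex.mul_conj]
  ext i j
  have h4 := (Finset.sum_eq_zero_iff_of_nonneg (fun i _ =>
    Finset.sum_nonneg fun j _ => Complex.normSq_nonneg (A i j))).1 (h3.symm.trans h)
    i (Finset.mem_univ i)
  exact Complex.normSq_eq_zero.1 ((Finset.sum_eq_zero_iff_of_nonneg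
    (fun j _ => Complex.normSq_nonneg (A i j))).1 h4 j (Finset.mem_univ j))

theorem formC_nondegenerate (z : GL (Fin n) ℂ) : (formC z).Nondegenerate := by
  have key : ∀ X : Matrix (Fin n) (Fin n) ℂ, (∀ Y, formC z X Y = 0) → X = 0 := by
    intro X h
    have h1 := h (z.val * ((z⁻¹).val * X)ᴴ)
    rw [formC_apply, ← mul_assoc (z⁻¹).val z.val, Units.inv_mul, one_mul] at h1
    have h2 : (z⁻¹).val * X = 0 :=
      eq_zero_of_trace_re _ (by simpa using h1)
    simpa using congrArg (fun A => z.val * A) h2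
  exact ⟨fun X h => key X h, fun X h => key X fun Y => by rw [(formC_symm z).eq]; exact h Y⟩

theorem formR_nondegenerate (x : GL (Fin n) ℝ) : (formR x).Nondegenerate := by
  have key : ∀ X : Matrix (Fin n) (Fin n) ℝ, (∀ Y, formR x X Y = 0) → X = 0 := by
    intro X h
    have h1 := h (x.val * ((x⁻¹).val * X)ᴴ)
    rw [formR_apply, ← mul_assoc (x⁻¹).val x.val, Units.inv_mul, one_mul, neg_eq_zero] at h1
    have h2 := Matrix.trace_mul_conjTranspose_self_eq_zero_iff.1 h1
    simpa using congrArg (fun A => x.val * A) h2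
  exact ⟨fun X h => key X h, fun X h => key X fun Y => by rw [(formR_symm x).eq]; exact h Y⟩

theorem smooth_aux {R : Type*} [NormedRing R] [CompleteSpace R] [NormedAlgebra ℝ R]
    (F : ∀ x : Rˣ, LinearMap.BilinForm ℝ (TangentSpace 𝓘(ℝ, R) x)) (T : R →L[ℝ] ℝ)
    (hF : ∀ (x : Rˣ) (u w : R), F x u w = -T ((x⁻¹).val * u * ((x⁻¹).val * w)))
    (p : Rˣ) (u w : R) : ContDiffOn ℝ ∞ (coordCoeff F p u w) (chartAt R p).target := by
  have h : ContDiffOn ℝ ∞ (Ring.inverse : R → R) (chartAt R p).target := fun y hy => by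
    have h1 : (((chartAt R p).symm y : Rˣ) : R) = y := (chartAt R p).right_inv hy
    rw [← h1]
    exact (contDiffAt_ringInverse ℝ _).contDiffWithinAt
  have h2 : ContDiffOn ℝ ∞ (fun y => -T (Ring.inverse y * u * (Ring.inverse y * w)))
      (chartAt R p).target :=
    (T.contDiff.comp_contDiffOn ((h.mul contDiffOn_const).mul (h.mul contDiffOn_const))).neg
  refine h2.congr fun y hy => ?_
  have h1 : (((chartAt R p).symm y : Rˣ) : R) = y := (chartAt R p).right_inv hy
  have h3 : Ring.inverse y = ((((chartAt R p).symm y)⁻¹ : Rˣ) : R) := by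
    conv_lhs => rw [← h1]
    exact Ring.inverse_unit _
  rw [coordCoeff, coordVec_units p u y hy, coordVec_units p w y hy, hF, h3]

variable (n)

/-- The natural semi-Riemannian metric of `GL(n, ℂ)`: the left-invariant metric with
`g(Z, W) = -Re tr(Z W)` on the Lie algebra. -/
def metricC : Metric (Matrix (Fin n) (Fin n) ℂ) (GL (Fin n) ℂ) where
  form := formC
  symm := formC_symm
  nondegenerate := formC_nondegenerate
  smooth := smooth_aux formC
    (Complex.reCLM.comp (LinearMap.toContinuousLinearMap
      (Matrix.traceLinearMap (Fin n) ℝ ℂ))) formC_apply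

/-- The semi-Riemannian metric of `GL(n, ℝ)` induced from `metricC` by the inclusion. -/
def metricR : Metric (Matrix (Fin n) (Fin n) ℝ) (GL (Fin n) ℝ) where
  form := formR
  symm := formR_symm
  nondegenerate := formR_nondegenerate
  smooth := smooth_aux formR
    (LinearMap.toContinuousLinearMap (Matrix.traceLinearMap (Fin n) ℝ ℝ)) formR_apply

variable {n} in
/-- The function `φ_a(x) = tr(vᵗ a xᵗ)` on `GL(n, ℝ)`, where `v` and `a` are regarded as row
vectors, so that `vᵗ a` is the `n × n` matrix with entries `v i * a j`. -/
def phi (v a : Fin n → ℂ) (x : GL (Fin n) ℝ) : ℂ :=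
  (Matrix.vecMulVec v a * (x.val.map Complex.ofReal)ᵀ).trace

variable {n} in
/-- The family `𝓔_v` of all the functions `φ_a` with `a ∈ ℂⁿ`. -/
def family (v : Fin n → ℂ) : Set (GL (Fin n) ℝ → ℂ) :=
  Set.range (phi v)

end GeneralLinear

end SemiRiemannian

end

noncomputable section
namespace SemiRiemannian

open scoped Topology

variable {n : ℕ}

/-! The preferred charts are all restrictions of the inclusion of `GL (Fin n) ℝ` in the matrices. In
the coordinates `y k l` the function `φ_a` is linear, with constant partial derivatives `v k * a l`,
so only the metric remains to be computed.

From `g(X, Y) = -tr(y⁻¹ X y⁻¹ Y)` one reads off the Gram matrix; its inverse has the entries `-(y k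
s * y r l)` at `(k, l), (r, s)` (`gram_metricR_inv`), and `√|g| = |det y|⁻ⁿ`
(`sqrt_abs_det_gram_metricR`). Contracting the inverse with two gradients gives `-φ_a φ_c`, because
both functions share the vector `v`.

For `τ`, Jacobi's formula for the derivative of `|det y|⁻ⁿ` contributes `n φ_a`, and each of the two
factors of `g^ij` contributes `-n φ_a`; the total is `-n φ_a` (`partialDeriv_flux`, `sum_flux`). -/

/-- The complex linear extension `X ↦ ∑ k l, v k * a l * X k l` of `phi v a` to all matrices. -/
def phiLin (v a : Fin n → ℂ) : Matrix (Fin n) (Fin n) ℝ →L[ℝ] ℂ :=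
  LinearMap.toContinuousLinearMap
    { toFun := fun X => ∑ k, ∑ l, v k * a l * (X k l : ℂ)
      map_add' := fun X Y => by simp [mul_add, Finset.sum_add_distrib]
      map_smul' := fun c X => by
        simp only [Matrix.smul_apply, smul_eq_mul, Complex.ofReal_mul, RingHom.id_apply,
          Complex.real_smul, Finset.mul_sum]
        exact Finset.sum_congr rfl fun k _ => Finset.sum_congr rfl fun l _ => by ring }

theorem phiLin_apply (v a : Fin n → ℂ) (X : Matrix (Fin n) (Fin n) ℝ) :
    phiLin v a X = ∑ k, ∑ l, v k * a l * (X k l : ℂ) := rfl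

theorem phiLin_single (v a : Fin n → ℂ) (k l : Fin n) :
    phiLin v a (Matrix.single k l 1) = v k * a l := by
  rw [phiLin_apply, Finset.sum_eq_single k, Finset.sum_eq_single l]
  · simp
  · intro j _ hj
    simp [hj.symm]
  · simp
  · intro i _ hi
    simp [hi.symm]
  · simp

theorem phi_eq_phiLin (v a : Fin n → ℂ) (x : GL (Fin n) ℝ) : phi v a x = phiLin v a x.val := by
  simp [phi, phiLin_apply, Matrix.trace, Matrix.mul_apply, Matrix.vecMulVec_apply]

/-! ### The functions and the metric in the chart -/

theorem val_chartAt_symm {p : GL (Fin n) ℝ} {y : Matrix (Fin n) (Fin n) ℝ}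
    (hy : y ∈ (chartAt (Matrix (Fin n) (Fin n) ℝ) p).target) :
    ((chartAt (Matrix (Fin n) (Fin n) ℝ) p).symm y).val = y :=
  (chartAt (Matrix (Fin n) (Fin n) ℝ) p).right_inv hy

theorem chartAt_target_mem_nhds (p : GL (Fin n) ℝ) {y : Matrix (Fin n) (Fin n) ℝ}
    (hy : y ∈ (chartAt (Matrix (Fin n) (Fin n) ℝ) p).target) :
    (chartAt (Matrix (Fin n) (Fin n) ℝ) p).target ∈ 𝓝 y :=
  (chartAt (Matrix (Fin n) (Fin n) ℝ) p).open_target.mem_nhds hy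

theorem partialDeriv_phi (v a : Fin n → ℂ) (p : GL (Fin n) ℝ) (i : Fin n × Fin n)
    {y : Matrix (Fin n) (Fin n) ℝ} (hy : y ∈ (chartAt (Matrix (Fin n) (Fin n) ℝ) p).target) :
    partialDeriv (Matrix.stdBasis ℝ (Fin n) (Fin n)) i
      (phi v a ∘ (chartAt (Matrix (Fin n) (Fin n) ℝ) p).symm) y = v i.1 * a i.2 := by
  have h : phi v a ∘ (chartAt (Matrix (Fin n) (Fin n) ℝ) p).symm =ᶠ[𝓝 y] phiLin v a := by
    filter_upwards [chartAt_target_mem_nhds p hy] with z hz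
    rw [Function.comp_apply, phi_eq_phiLin, val_chartAt_symm hz]
  rw [partialDeriv, h.lineDeriv_eq, ((phiLin v a).hasFDerivAt.hasLineDerivAt _).lineDeriv,
    Matrix.stdBasis_eq_single, phiLin_single]

theorem trace_mul_single_mul_mul_single (B : Matrix (Fin n) (Fin n) ℝ) (i j k l : Fin n) :
    (B * Matrix.single i j 1 * (B * Matrix.single k l 1)).trace = B j k * B l i := by
  simp [Matrix.trace, Matrix.mul_apply, Matrix.single_apply, ite_and, mul_comm]

theorem gram_metricR (p : GL (Fin n) ℝ) {y : Matrix (Fin n) (Fin n) ℝ}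
    (hy : y ∈ (chartAt (Matrix (Fin n) (Fin n) ℝ) p).target) :
    (metricR n).gram (Matrix.stdBasis ℝ (Fin n) (Fin n)) p y =
      Matrix.of fun i j => -(y⁻¹ i.2 j.1 * y⁻¹ j.2 i.1) := by
  ext i j
  have h : (((chartAt (Matrix (Fin n) (Fin n) ℝ) p).symm y)⁻¹).val = y⁻¹ := by
    rw [Matrix.coe_units_inv, val_chartAt_symm hy]
  simp only [Metric.gram, Matrix.of_apply, coordCoeff]
  rw [coordVec_units p _ y hy, coordVec_units p _ y hy, ← trace_mul_single_mul_mul_single, ← h,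
    Matrix.stdBasis_eq_single, Matrix.stdBasis_eq_single]
  exact formR_apply _ _ _

theorem det_ne_zero_of_mem_target {p : GL (Fin n) ℝ} {y : Matrix (Fin n) (Fin n) ℝ}
    (hy : y ∈ (chartAt (Matrix (Fin n) (Fin n) ℝ) p).target) : y.det ≠ 0 := by
  rw [← val_chartAt_symm hy]
  exact (Matrix.isUnit_iff_isUnit_det _).1 (Units.isUnit _) |>.ne_zero

/-- The double sum in the product with the Gram matrix separates into an entry of `y⁻¹ * y` times an
entry of `y * y⁻¹`. -/
theorem gram_metricR_inv (p : GL (Fin n) ℝ) {y : Matrix (Fin n) (Fin n) ℝ}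
    (hy : y ∈ (chartAt (Matrix (Fin n) (Fin n) ℝ) p).target) :
    ((metricR n).gram (Matrix.stdBasis ℝ (Fin n) (Fin n)) p y)⁻¹ =
      Matrix.of fun i j => -(y i.1 j.2 * y j.1 i.2) := by
  have h : y⁻¹ * y = 1 := Matrix.nonsing_inv_mul y (det_ne_zero_of_mem_target hy).isUnit
  have h' : y * y⁻¹ = 1 := Matrix.mul_nonsing_inv y (det_ne_zero_of_mem_target hy).isUnit
  rw [gram_metricR p hy]
  refine Matrix.inv_eq_right_inv ?_
  ext ⟨i, j⟩ ⟨k, l⟩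
  rw [Matrix.mul_apply, Fintype.sum_prod_type]
  have : ∀ r s, (-(y⁻¹ j r * y⁻¹ s i)) * (-(y r l * y k s)) =
      (y⁻¹ j r * y r l) * (y k s * y⁻¹ s i) := fun r s => by ring
  simp only [Matrix.of_apply, this]
  rw [← Finset.sum_mul_sum, ← Matrix.mul_apply, ← Matrix.mul_apply, h, h']
  by_cases h1 : i = k <;> by_cases h2 : j = l <;> simp [Matrix.one_apply, h1, h2, eq_comm (a := k)]

/-- Up to sign and a swap of the column indices, neither of which affects `|det|`, the Gram matrix
is the Kronecker product of `(y⁻¹)ᵀ` and `y⁻¹`, of determinant `(det y)⁻²ⁿ`. -/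
theorem sqrt_abs_det_gram_metricR (p : GL (Fin n) ℝ) {y : Matrix (Fin n) (Fin n) ℝ}
    (hy : y ∈ (chartAt (Matrix (Fin n) (Fin n) ℝ) p).target) :
    √|((metricR n).gram (Matrix.stdBasis ℝ (Fin n) (Fin n)) p y).det| = (|y.det|⁻¹) ^ n := by
  have h : (Matrix.of fun i j : Fin n × Fin n => -(y⁻¹ i.2 j.1 * y⁻¹ j.2 i.1)) =
      -((Matrix.kronecker (y⁻¹)ᵀ y⁻¹).submatrix (Equiv.refl _) (Equiv.prodComm _ _)) := by
    ext i j
    simp [Matrix.kroneckerMap_apply, mul_comm]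
  rw [gram_metricR p hy, h, Matrix.det_neg, abs_mul, abs_pow, abs_neg, abs_one, one_pow, one_mul,
    Matrix.abs_det_submatrix_equiv_equiv, Matrix.kronecker, Matrix.det_kronecker, Matrix.det_transpose,
    Matrix.det_nonsing_inv, Ring.inverse_eq_inv', Fintype.card_fin, ← sq, abs_pow, abs_pow,
    abs_inv, Real.sqrt_sq (by positivity)]

/-! ### Derivatives in the coordinates and the tension field -/

theorem det_add_smul_single (y : Matrix (Fin n) (Fin n) ℝ) (k l : Fin n) (t : ℝ) :
    (y + t • Matrix.single k l 1).det = y.det + t * y.adjugate l k := by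
  -- Only row `k` changes, and the determinant is linear in that row.
  have h : y + t • Matrix.single k l 1 = y.updateRow k (y k + t • Pi.single l 1) := by
    ext i j
    by_cases hi : i = k
    · subst hi
      simp [Matrix.single_apply, Pi.single_apply, eq_comm]
    · simp [Matrix.updateRow_ne hi, Ne.symm hi]
  rw [h, Matrix.det_updateRow_add, Matrix.det_updateRow_smul, Matrix.adjugate_apply,
    Matrix.updateRow_eq_self]

/-- Jacobi's formula: the logarithmic derivative of `|det y|` along the coordinate `(k, l)` is `y⁻¹
l k`, whatever the sign of `det y`. -/
theorem hasDerivAt_inv_abs_det_pow (y : Matrix (Fin n) (Fin n) ℝ) (hy : y.det ≠ 0) (k l : Fin n)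
    (m : ℕ) : HasDerivAt (fun t : ℝ => (|(y + t • Matrix.single k l 1).det|⁻¹) ^ m)
      (-(m * y⁻¹ l k * (|y.det|⁻¹) ^ m)) 0 := by
  have h1 : HasDerivAt (fun t : ℝ => y.det + t * y.adjugate l k) (y.adjugate l k) 0 := by
    simpa using ((hasDerivAt_id (0 : ℝ)).mul_const (y.adjugate l k)).const_add y.det
  have h0 : y.det + 0 * y.adjugate l k ≠ 0 := by simpa using hy
  have h2 : HasDerivAt (fun t : ℝ => |y.det + t * y.adjugate l k|)
      (SignType.sign (y.det + 0 * y.adjugate l k) * y.adjugate l k) 0 :=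
    HasDerivAt.comp (h₂ := fun x : ℝ => |x|) 0 (hasDerivAt_abs h0) h1
  simp only [det_add_smul_single]
  refine ((h2.fun_inv (abs_ne_zero.2 h0)).fun_pow m).congr_deriv ?_
  have hi : y⁻¹ l k = y.det⁻¹ * y.adjugate l k := by
    simp [Matrix.inv_def, Ring.inverse_eq_inv']
  rw [hi]
  simp only [zero_mul, add_zero]
  -- The power rule involves the truncated exponent `m - 1`, so `m = 0` is treated apart.
  rcases m with _ | m
  · simp
  · rcases lt_or_gt_of_ne hy with h | h
    · simp [abs_of_neg h, sign_neg h, pow_succ]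
      field_simp
    · simp [abs_of_pos h, sign_pos h, pow_succ]
      field_simp

theorem hasDerivAt_apply_add_smul_single (y : Matrix (Fin n) (Fin n) ℝ) (k l r s : Fin n) :
    HasDerivAt (fun t : ℝ => (y + t • Matrix.single k l (1 : ℝ) : Matrix _ _ ℝ) r s)
      (if k = r ∧ l = s then 1 else 0) 0 := by
  simpa [Matrix.single_apply] using
    ((hasDerivAt_id (0 : ℝ)).mul_const ((Matrix.single k l (1 : ℝ)) r s)).const_add (y r s)

/-- The derivative in the direction of a coordinate of `g^ij √|g| ∂_i φ`. -/
theorem partialDeriv_flux (v a : Fin n → ℂ) (p : GL (Fin n) ℝ) (k l r s : Fin n) :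
    partialDeriv (Matrix.stdBasis ℝ (Fin n) (Fin n)) (r, s)
      (fun y => ((((metricR n).gram (Matrix.stdBasis ℝ (Fin n) (Fin n)) p y)⁻¹ (k, l) (r, s) *
          √|((metricR n).gram (Matrix.stdBasis ℝ (Fin n) (Fin n)) p y).det| : ℝ) : ℂ) *
        partialDeriv (Matrix.stdBasis ℝ (Fin n) (Fin n)) (k, l)
          (phi v a ∘ (chartAt (Matrix (Fin n) (Fin n) ℝ) p).symm) y) p.val =
      (((|p.val.det|⁻¹) ^ n * (n * p.val⁻¹ s r * p.val k s * p.val r l -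
        (if r = k then p.val r l else 0) - (if s = l then p.val k s else 0)) : ℝ) : ℂ) *
        (v k * a l) := by
  have hp : p.val ∈ (chartAt (Matrix (Fin n) (Fin n) ℝ) p).target := mem_chart_target _ p
  -- Near `p` the factor `∂_i φ` is constant, so the product rule only meets the two entries of `y`
  -- and the power of `|det y|`.
  have h : (fun y => ((((metricR n).gram (Matrix.stdBasis ℝ (Fin n) (Fin n)) p y)⁻¹ (k, l) (r, s) *
          √|((metricR n).gram (Matrix.stdBasis ℝ (Fin n) (Fin n)) p y).det| : ℝ) : ℂ) *
        partialDeriv (Matrix.stdBasis ℝ (Fin n) (Fin n)) (k, l)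
          (phi v a ∘ (chartAt (Matrix (Fin n) (Fin n) ℝ) p).symm) y) =ᶠ[𝓝 p.val]
      fun y => ((-(y k s * y r l) * (|y.det|⁻¹) ^ n : ℝ) : ℂ) * (v k * a l) := by
    filter_upwards [chartAt_target_mem_nhds p hp] with y hy
    rw [gram_metricR_inv p hy, sqrt_abs_det_gram_metricR p hy, partialDeriv_phi v a p _ hy]
    rfl
  rw [partialDeriv, h.lineDeriv_eq, Matrix.stdBasis_eq_single]
  refine HasLineDerivAt.lineDeriv ?_
  have h1 := (((hasDerivAt_apply_add_smul_single p.val r s k s).fun_mul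
    (hasDerivAt_apply_add_smul_single p.val r s r l)).fun_neg.fun_mul
    (hasDerivAt_inv_abs_det_pow p.val (det_ne_zero_of_mem_target hp) r s n)).ofReal_comp.mul_const
      (v k * a l)
  refine h1.congr_deriv ?_
  congr 2
  simp only [zero_smul, add_zero, and_true, true_and]
  split_ifs <;> ring

/-- The first term sums to `n x x⁻¹ x = n x`. Each Kronecker delta leaves one index free, with `n`
values, and so gives `-n x`. -/
theorem sum_flux (x : Matrix (Fin n) (Fin n) ℝ) (hx : x.det ≠ 0) (k l : Fin n) :
    ∑ r, ∑ s, ((n : ℝ) * x⁻¹ s r * x k s * x r l -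
        (if r = k then x r l else 0) - (if s = l then x k s else 0)) = -(n * x k l) := by
  have h : ∑ r, ∑ s, (n : ℝ) * x⁻¹ s r * x k s * x r l = n * x k l := by
    conv_rhs => rw [← Matrix.mul_one x, ← Matrix.nonsing_inv_mul x hx.isUnit, ← Matrix.mul_assoc]
    simp only [Matrix.mul_apply, Finset.sum_mul, Finset.mul_sum]
    exact Finset.sum_congr rfl fun r _ => Finset.sum_congr rfl fun s _ => by ring
  simp only [Finset.sum_sub_distrib, h]
  simp

theorem tension_phi (v a : Fin n → ℂ) (p : GL (Fin n) ℝ) :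
    tension (metricR n) (Matrix.stdBasis ℝ (Fin n) (Fin n)) (phi v a) p = -(n : ℂ) * phi v a p := by
  have hp : p.val ∈ (chartAt (Matrix (Fin n) (Fin n) ℝ) p).target := mem_chart_target _ p
  have hd := det_ne_zero_of_mem_target hp
  have hc : chartAt (Matrix (Fin n) (Fin n) ℝ) p p = p.val := rfl
  rw [tension, phi_eq_phiLin, phiLin_apply, Fintype.sum_prod_type, Finset.mul_sum]
  refine Finset.sum_congr rfl fun k _ => ?_
  rw [Finset.mul_sum]
  refine Finset.sum_congr rfl fun l _ => ?_
  have hn : 1 / (|p.val.det|⁻¹) ^ n * (|p.val.det|⁻¹) ^ n = 1 :=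
    one_div_mul_cancel (pow_ne_zero _ (inv_ne_zero (abs_ne_zero.2 hd)))
  -- The prefactor `1 / √|g|` cancels the power of `|det|` produced by the flux.
  have hs : ∀ c : ℝ, ((1 / (|p.val.det|⁻¹) ^ n : ℝ) : ℂ) *
      ((((|p.val.det|⁻¹) ^ n * c : ℝ) : ℂ) * (v k * a l)) = (c : ℂ) * (v k * a l) := fun c => by
    rw [← mul_assoc, ← Complex.ofReal_mul, ← mul_assoc (1 / _), hn, one_mul]
  simp only [hc, sqrt_abs_det_gram_metricR p hp]
  rw [Fintype.sum_prod_type]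
  simp only [partialDeriv_flux, hs, ← Finset.sum_mul, ← Complex.ofReal_sum]
  rw [sum_flux _ hd]
  push_cast
  ring

/-! ### The conformality operator -/

theorem conformality_phi (v a c : Fin n → ℂ) (p : GL (Fin n) ℝ) :
    conformality (metricR n) (Matrix.stdBasis ℝ (Fin n) (Fin n)) (phi v a) (phi v c) p =
      -1 * (phi v a p * phi v c p) := by
  have hp : p.val ∈ (chartAt (Matrix (Fin n) (Fin n) ℝ) p).target := mem_chart_target _ p
  have hc : chartAt (Matrix (Fin n) (Fin n) ℝ) p p = p.val := rfl
  simp only [conformality, hc, gram_metricR_inv p hp, partialDeriv_phi _ _ p _ hp, phi_eq_phiLin,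
    phiLin_apply, Fintype.sum_prod_type, Matrix.of_apply]
  -- The inverse metric crosses the index pairs. As `v` is common to both functions, `v i` and `v k`
  -- can trade places, and the summand splits into a term of `φ_a` and a term of `φ_c`.
  have h : ∀ i j k l : Fin n, ((-(p.val i l * p.val k j) : ℝ) : ℂ) * (v i * a j) * (v k * c l) =
      -1 * (v k * a j * (p.val k j : ℂ) * (v i * c l * (p.val i l : ℂ))) := fun i j k l => by
    push_cast
    ring
  simp only [h, ← Finset.mul_sum]
  congr 1
  simp only [Finset.sum_mul]
  rw [Finset.sum_congr rfl fun i _ => Finset.sum_comm, Finset.sum_comm]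
  refine Finset.sum_congr rfl fun k _ => ?_
  rw [Finset.sum_comm]
  simp only [Finset.mul_sum]

/-! ### Smoothness and dimension -/

theorem contMDiff_phi (v a : Fin n → ℂ) :
    ContMDiff 𝓘(ℝ, Matrix (Fin n) (Fin n) ℝ) 𝓘(ℝ, ℂ) ∞ (phi v a) := by
  rw [show phi v a = phiLin v a ∘ Units.val from funext (phi_eq_phiLin v a)]
  exact (phiLin v a).contMDiff.comp Units.contMDiff_val

/-- The linear map `a ↦ φ_a`. -/
def phiMap (v : Fin n → ℂ) : (Fin n → ℂ) →ₗ[ℂ] (GL (Fin n) ℝ → ℂ) where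
  toFun := phi v
  map_add' a c := by
    ext x
    simp [phi_eq_phiLin, phiLin_apply, mul_add, add_mul, Finset.sum_add_distrib]
  map_smul' z a := by
    ext x
    simp only [phi_eq_phiLin, phiLin_apply, Pi.smul_apply, smul_eq_mul, RingHom.id_apply,
      Finset.mul_sum]
    exact Finset.sum_congr rfl fun k _ => Finset.sum_congr rfl fun l _ => by ring

/-- The products `v k * a l` are recovered from `φ_a` as partial derivatives at the identity; a
nonzero `v k` then cancels. -/
theorem phiMap_injective {v : Fin n → ℂ} (hv : v ≠ 0) : Function.Injective (phiMap v) := by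
  obtain ⟨k, hk⟩ := Function.ne_iff.1 hv
  refine fun a c h => funext fun l => mul_left_cancel₀ hk ?_
  have h' : phi v a = phi v c := h
  have hp := mem_chart_target (Matrix (Fin n) (Fin n) ℝ) (1 : GL (Fin n) ℝ)
  have ha := partialDeriv_phi v a 1 (k, l) hp
  rw [h', partialDeriv_phi v c 1 (k, l) hp] at ha
  exact ha.symm

end SemiRiemannian
end

theorem theorem6p2 (n : ℕ) (v : Fin n → ℂ) (hv : v ≠ 0) :
    (∃ W : Submodule ℂ (GL (Fin n) ℝ → ℂ),
      (W : Set (GL (Fin n) ℝ → ℂ)) = SemiRiemannian.family v ∧ Module.finrank ℂ W = n) ∧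
    SemiRiemannian.IsEigenfamilyWith (SemiRiemannian.metricR n)
      (Matrix.stdBasis ℝ (Fin n) (Fin n)) (SemiRiemannian.family v) (-(n : ℂ)) (-1) := by
  refine ⟨⟨LinearMap.range (SemiRiemannian.phiMap v), LinearMap.coe_range _, ?_⟩, ?_, ?_, ?_⟩
  · rw [LinearMap.finrank_range_of_inj (SemiRiemannian.phiMap_injective hv), Module.finrank_fin_fun]
  · rintro _ ⟨a, rfl⟩
    exact SemiRiemannian.contMDiff_phi v a
  · rintro _ ⟨a, rfl⟩ p
    exact SemiRiemannian.tension_phi v a p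
  · rintro _ ⟨a, rfl⟩ _ ⟨c, rfl⟩ p
    exact SemiRiemannian.conformality_phi v a c p
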